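/- Let $\mathbb{F}_q$ be a finite field with $q$ elements, let $\sigma\in\mathbb{F}_q^{*}$, and let $n\ge 1$ be an integer. The number of monic irreducible polynomials $g\in\mathbb{F}_q[x]$ of degree $2n$ which satisfy $x^{2n}\cdot g(\sigma/x)=\sigma^n g(x)$ equals \[ \frac{1}{2n}\Bigl(-\delta+\sum_{d\mid n,\ d\ \text{odd}}\mu(d)\,q^{n/d}\Bigr), \] where $\mu$ is the Möbius function and \[ \delta=\begin{cases} 1 & \text{if $q$ is odd and $n>1$ is a power of $2$,}\\ 1 & \text{if $q$ is odd, $n=1$, and $\sigma$ is a square in $\mathbb{F}_q$,}\\ -1 & \text{if $q$ is odd, $n=1$, and $\sigma$ is not a square in $\mathbb{F}_q$,}\\ 0 & \text{otherwise.} \end{cases} \] -/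

import Mathlib

/-- The correction term `δ` (with `q` the size of the finite field `F`): it is `1` if `q` is odd and
`n > 1` is a power of `2`, or if `q` is odd, `n = 1` and `σ` is a square in `F`; it is `-1` if `q`
is odd, `n = 1` and `σ` is not a square in `F`; and it is `0` otherwise. -/
noncomputable def delta {F : Type*} [Field F] [Fintype F] (n : ℕ) (σ : F) : ℤ :=
  open scoped Classical in
  if Odd (Fintype.card F) ∧ 1 < n ∧ ∃ k : ℕ, n = 2 ^ k then 1
  else if Odd (Fintype.card F) ∧ n = 1 ∧ IsSquare σ then 1
  else if Odd (Fintype.card F) ∧ n = 1 ∧ ¬ IsSquare σ then -1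
  else 0

/-- The set of monic irreducible polynomials `g` of degree `2n` over `F` which satisfy
`x ^ (2n) * g (σ / x) = σ ^ n * g (x)`, an identity in the field `F(x)` of rational functions. -/
def invariantIrreducibles (F : Type*) [Field F] (n : ℕ) (σ : F) : Set (Polynomial F) :=
  {g | g.Monic ∧ Irreducible g ∧ g.natDegree = 2 * n ∧
    (RatFunc.X : RatFunc F) ^ (2 * n) * Polynomial.aeval (RatFunc.C σ / RatFunc.X) g =
      RatFunc.C σ ^ n * Polynomial.aeval (RatFunc.X : RatFunc F) g}

/-!
Let `φ` be the `q`-Frobenius of an algebraic closure of `F` and `ι` the involution `x ↦ σ / x`,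
which commutes with `φ`. The roots of an irreducible polynomial form one `φ`-orbit, so the
polynomials to be counted are the minimal polynomials of the points `x` of minimal period `2n` with
`φⁿ x = ι x`. If merely `φⁿ x = ι x ≠ x`, then `x` has minimal period `2n / d` for an odd divisor
`d` of `n`, and already `φ^(n/d) x = ι x`. Now `φⁿ x = ι x` is the equation `x ^ (qⁿ + 1) = σ`, with
`qⁿ + 1` solutions, from which one removes the square roots of `σ` fixed by `φⁿ`; Möbius inversion
over odd divisors gives the count, the square roots contributing `δ`.
-/

open Polynomial Function

section OddDivisors

open scoped ArithmeticFunction.Moebius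

theorem filter_odd_divisors_two_pow_mul (k : ℕ) {m : ℕ} (hm : Odd m) :
    {d ∈ (2 ^ k * m).divisors | Odd d} = m.divisors := by
  ext d
  have h0 : 2 ^ k * m ≠ 0 := mul_ne_zero (pow_ne_zero k two_ne_zero) hm.pos.ne'
  simp only [Finset.mem_filter, Nat.mem_divisors, h0, hm.pos.ne', ne_eq, not_false_eq_true,
    and_true]
  refine ⟨fun ⟨h, hd⟩ ↦ ?_, fun h ↦ ⟨h.mul_left _, hm.of_dvd_nat h⟩⟩
  exact (Nat.Coprime.pow_right k (Nat.coprime_two_right.2 hd)).dvd_of_dvd_mul_left h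

theorem exists_two_pow_mul_odd_eq_two_pow_iff (k : ℕ) {m : ℕ} (hm : Odd m) :
    (∃ l, 2 ^ k * m = 2 ^ l) ↔ m = 1 := by
  refine ⟨fun ⟨l, hl⟩ ↦ ?_, fun h ↦ ⟨k, by rw [h, mul_one]⟩⟩
  exact Nat.Coprime.eq_one_of_dvd (Nat.Coprime.pow_right l (Nat.coprime_two_right.2 hm))
    (hl ▸ dvd_mul_left m (2 ^ k))

theorem sum_divisors_moebius (m : ℕ) : ∑ d ∈ m.divisors, μ d = if m = 1 then 1 else 0 := by
  rw [← ArithmeticFunction.coe_mul_zeta_apply, ArithmeticFunction.moebius_mul_coe_zeta,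
    ArithmeticFunction.one_apply]

open scoped Classical in
theorem sum_odd_divisors_moebius {n : ℕ} (hn : n ≠ 0) :
    ∑ d ∈ n.divisors with Odd d, μ d = if ∃ k, n = 2 ^ k then 1 else 0 := by
  obtain ⟨k, m, hm, rfl⟩ := Nat.exists_eq_two_pow_mul_odd hn
  simp only [filter_odd_divisors_two_pow_mul k hm, sum_divisors_moebius,
    exists_two_pow_mul_odd_eq_two_pow_iff k hm]

theorem eq_sum_odd_divisors_moebius_smul {R : Type*} [AddCommGroup R] {f g : ℕ → R}
    (h : ∀ n ≠ 0, ∑ d ∈ n.divisors with Odd d, f (n / d) = g n) {n : ℕ} (hn : n ≠ 0) :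
    f n = ∑ d ∈ n.divisors with Odd d, μ d • g (n / d) := by
  obtain ⟨k, m, hm, rfl⟩ := Nat.exists_eq_two_pow_mul_odd hn
  have hdiv {j d : ℕ} (hd : d ∈ j.divisors) : 2 ^ k * j / d = 2 ^ k * (j / d) :=
    Nat.mul_div_assoc _ (Nat.dvd_of_mem_divisors hd)
  have hsum (j : ℕ) (hj : j > 0) (hodd : Odd j) :
      ∑ e ∈ j.divisors, f (2 ^ k * e) = g (2 ^ k * j) := by
    rw [← h _ (mul_ne_zero (pow_ne_zero k two_ne_zero) hj.ne'),
      filter_odd_divisors_two_pow_mul k hodd, ← Nat.sum_div_divisors]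
    exact Finset.sum_congr rfl fun d hd ↦ by rw [hdiv hd]
  have hinv := (ArithmeticFunction.sum_eq_iff_sum_smul_moebius_eq_on {j | Odd j}
    fun _ _ hab hb ↦ Odd.of_dvd_nat hb hab).1 hsum m hm.pos hm
  rw [filter_odd_divisors_two_pow_mul k hm, ← hinv,
    Nat.sum_divisorsAntidiagonal fun a b ↦ μ a • g (2 ^ k * b)]
  exact Finset.sum_congr rfl fun d hd ↦ by rw [hdiv hd]

end OddDivisors

section HalfPeriod

variable {α : Type*} {f ι : α → α} {x : α} {m n : ℕ}

/-- The points of minimal period `2n` under `f` at which the half-period iterate `f^[n]` agrees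
with `ι`. For `f` the Frobenius and `ι` the inversion `x ↦ σ / x`, these are the roots of the
polynomials to be counted. -/
def halfPeriodPts (f ι : α → α) (n : ℕ) : Set α :=
  {x | f^[n] x = ι x ∧ minimalPeriod f x = 2 * n}

theorem iterate_mul_odd (h : IsPeriodicPt f (2 * m) x) {c : ℕ} (hc : Odd c) :
    f^[m * c] x = f^[m] x := by
  obtain ⟨t, rfl⟩ := hc
  rw [show m * (2 * t + 1) = m + 2 * m * t by ring, iterate_add_apply, h.mul_const t]

theorem isPeriodicPt_two_mul_of_iterate_eq (hcomm : Function.Commute f ι) (hι : Involutive ι)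
    (h : f^[n] x = ι x) : IsPeriodicPt f (2 * n) x := by
  rw [IsPeriodicPt, IsFixedPt, two_mul, iterate_add_apply, h, (hcomm.iterate_left n).eq, h, hι]

theorem ne_of_mem_halfPeriodPts (hn : n ≠ 0) (h : x ∈ halfPeriodPts f ι n) : ι x ≠ x := by
  intro hx
  have hdvd := IsPeriodicPt.minimalPeriod_dvd (h.1.trans hx)
  rw [h.2] at hdvd
  have := Nat.le_of_dvd (Nat.pos_of_ne_zero hn) hdvd
  lia

theorem iterate_mem_halfPeriodPts (hcomm : Function.Commute f ι) (hn : n ≠ 0)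
    (h : x ∈ halfPeriodPts f ι n) (k : ℕ) : f^[k] x ∈ halfPeriodPts f ι n := by
  have hx : x ∈ periodicPts f := minimalPeriod_pos_iff_mem_periodicPts.1 (by rw [h.2]; lia)
  refine ⟨?_, (minimalPeriod_apply_iterate hx k).trans h.2⟩
  rw [← iterate_add_apply, add_comm, iterate_add_apply, h.1, (hcomm.iterate_left k).eq]

theorem exists_odd_mem_halfPeriodPts (hcomm : Function.Commute f ι) (hι : Involutive ι)
    (h : f^[n] x = ι x) (hne : ι x ≠ x) : ∃ m d, n = m * d ∧ Odd d ∧ x ∈ halfPeriodPts f ι m := by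
  have hdvd := (isPeriodicPt_two_mul_of_iterate_eq hcomm hι h).minimalPeriod_dvd
  have hndvd : ¬ minimalPeriod f x ∣ n := fun hd ↦
    hne (h.symm.trans (isPeriodicPt_iff_minimalPeriod_dvd.2 hd))
  have heven : Even (minimalPeriod f x) := by
    by_contra hodd
    have hcop := Nat.coprime_two_right.2 (Nat.not_even_iff_odd.1 hodd)
    exact hndvd (hcop.dvd_of_dvd_mul_left hdvd)
  obtain ⟨m, hm⟩ := heven.two_dvd
  rw [hm] at hdvd hndvd
  obtain ⟨d, rfl⟩ := Nat.dvd_of_mul_dvd_mul_left two_pos hdvd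
  have hd : Odd d := Nat.not_even_iff_odd.1 fun hd ↦ by
    obtain ⟨t, rfl⟩ := hd.two_dvd
    exact hndvd ⟨t, by ring⟩
  refine ⟨m, d, rfl, hd, ?_, hm⟩
  rw [← h, iterate_mul_odd (hm ▸ isPeriodicPt_minimalPeriod f x) hd]

theorem setOf_iterate_eq_eq_biUnion_halfPeriodPts (hcomm : Function.Commute f ι)
    (hι : Involutive ι) (hn : n ≠ 0) :
    {x | f^[n] x = ι x ∧ ι x ≠ x} =
      ⋃ d ∈ (n.divisors.filter Odd : Set ℕ), halfPeriodPts f ι (n / d) := by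
  ext x
  simp only [Set.mem_iUnion, Set.mem_ofPred_eq, Finset.mem_coe, Finset.mem_filter,
    Nat.mem_divisors, exists_prop]
  constructor
  · rintro ⟨h, hne⟩
    obtain ⟨m, d, rfl, hd, hx⟩ := exists_odd_mem_halfPeriodPts hcomm hι h hne
    exact ⟨d, ⟨⟨dvd_mul_left d m, hn⟩, hd⟩, by rwa [Nat.mul_div_cancel m hd.pos]⟩
  · rintro ⟨d, ⟨⟨⟨m, rfl⟩, -⟩, hd⟩, hx⟩
    rw [Nat.mul_div_cancel_left m hd.pos] at hx
    refine ⟨?_, ne_of_mem_halfPeriodPts (right_ne_zero_of_mul hn) hx⟩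
    rw [mul_comm, iterate_mul_odd (isPeriodicPt_two_mul_of_iterate_eq hcomm hι hx.1) hd, hx.1]

theorem disjoint_halfPeriodPts (f ι : α → α) (hmn : m ≠ n) :
    Disjoint (halfPeriodPts f ι m) (halfPeriodPts f ι n) :=
  Set.disjoint_left.2 fun _ hm hn ↦ hmn (Nat.eq_of_mul_eq_mul_left two_pos (hm.2.symm.trans hn.2))

theorem ncard_setOf_iterate_eq_eq_sum (hcomm : Function.Commute f ι) (hι : Involutive ι)
    (hn : n ≠ 0) (hfin : {x | f^[n] x = ι x ∧ ι x ≠ x}.Finite) :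
    {x | f^[n] x = ι x ∧ ι x ≠ x}.ncard =
      ∑ d ∈ n.divisors with Odd d, (halfPeriodPts f ι (n / d)).ncard := by
  rw [setOf_iterate_eq_eq_biUnion_halfPeriodPts hcomm hι hn] at hfin ⊢
  rw [Set.Finite.ncard_biUnion (Finset.finite_toSet _), finsum_mem_coe_finset]
  · exact fun d hd ↦ hfin.subset (Set.subset_biUnion_of_mem
      (u := fun d ↦ halfPeriodPts f ι (n / d)) hd)
  · intro d hd d' hd' hne
    simp only [Finset.mem_coe, Finset.mem_filter, Nat.mem_divisors] at hd hd'
    refine disjoint_halfPeriodPts f ι fun h ↦ hne ?_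
    exact (Nat.div_eq_iff_eq_of_dvd_dvd hn hd.1.1 hd'.1.1).1 h

end HalfPeriod

section InversionTransform

variable {F : Type*} [Field F] {σ : F} {N n : ℕ} {g : F[X]}

/-- The polynomial `X ^ N * g (σ / X)`, for `g` of degree at most `N`. It is obtained by reversing
the coefficients of `g (σ * X)`, so that no rational functions are needed. -/
noncomputable def inversionTransform (σ : F) (N : ℕ) (g : F[X]) : F[X] :=
  reflect N (g.comp (C σ * X))

theorem natDegree_comp_C_mul_X_le (σ : F) (g : F[X]) :
    (g.comp (C σ * X)).natDegree ≤ g.natDegree := by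
  calc (g.comp (C σ * X)).natDegree ≤ g.natDegree * (C σ * X).natDegree := natDegree_comp_le
    _ ≤ g.natDegree * 1 := Nat.mul_le_mul_left _ ((natDegree_C_mul_le σ X).trans natDegree_X_le)
    _ = g.natDegree := mul_one _

theorem natDegree_inversionTransform_le (σ : F) (hg : g.natDegree ≤ N) :
    (inversionTransform σ N g).natDegree ≤ N :=
  natDegree_reflect_le.trans (max_le le_rfl ((natDegree_comp_C_mul_X_le σ g).trans hg))

theorem coeff_zero_inversionTransform (σ : F) (N : ℕ) (g : F[X]) :
    (inversionTransform σ N g).coeff 0 = g.coeff N * σ ^ N := by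
  rw [inversionTransform, coeff_reflect, revAt_zero, comp_C_mul_X_coeff]

theorem aeval_inversionTransform {L : Type*} [Field L] [Algebra F L] (σ : F)
    (hg : g.natDegree ≤ N) {x : L} (hx : x ≠ 0) :
    aeval x (inversionTransform σ N g) = x ^ N * aeval (algebraMap F L σ / x) g := by
  let := invertibleOfNonzero (inv_ne_zero hx)
  have h := eval₂_reflect_mul_pow (algebraMap F L) x⁻¹ N (g.comp (C σ * X))
    ((natDegree_comp_C_mul_X_le σ g).trans hg)
  rw [invOf_eq_inv, inv_inv, ← aeval_def, ← aeval_def, aeval_comp, map_mul, aeval_C, aeval_X,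
    ← div_eq_mul_inv, inv_pow, ← div_eq_mul_inv, div_eq_iff (pow_ne_zero N hx)] at h
  rw [inversionTransform, h, mul_comm]

theorem mem_invariantIrreducibles_iff :
    g ∈ invariantIrreducibles F n σ ↔ g.Monic ∧ Irreducible g ∧ g.natDegree = 2 * n ∧
      inversionTransform σ (2 * n) g = C (σ ^ n) * g := by
  have haeval (p : F[X]) : aeval (RatFunc.X : RatFunc F) p = algebraMap F[X] (RatFunc F) p := by
    rw [← RatFunc.algebraMap_X, aeval_algebraMap_apply, aeval_X_left_apply]
  refine and_congr_right fun _ ↦ and_congr_right fun _ ↦ and_congr_right fun hdeg ↦ ?_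
  rw [← RatFunc.algebraMap_eq_C, ← aeval_inversionTransform σ hdeg.le RatFunc.X_ne_zero,
    ← map_pow, ← aeval_C (RatFunc.X : RatFunc F), ← map_mul, haeval, haeval,
    (RatFunc.algebraMap_injective F).eq_iff]

theorem coeff_zero_of_mem_invariantIrreducibles (hσ : σ ≠ 0)
    (hg : g ∈ invariantIrreducibles F n σ) : g.coeff 0 = σ ^ n := by
  obtain ⟨hmonic, -, hdeg, hinv⟩ := mem_invariantIrreducibles_iff.1 hg
  have h := congrArg (coeff · 0) hinv
  simp only [coeff_zero_inversionTransform, coeff_C_mul] at h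
  rw [← hdeg, hmonic.coeff_natDegree, one_mul, hdeg, two_mul, pow_add] at h
  exact (mul_left_cancel₀ (pow_ne_zero n hσ) h).symm

theorem sq_ne_of_mem_invariantIrreducibles [PerfectField F] {K : Type*} [Field K] [Algebra F K]
    (hσ : σ ≠ 0) (hg : g ∈ invariantIrreducibles F n σ) {x : K} (hx : aeval x g = 0) :
    x ^ 2 ≠ algebraMap F K σ := by
  intro hsq
  have hcoeff := coeff_zero_of_mem_invariantIrreducibles hσ hg
  obtain ⟨hmonic, hirr, hdeg, -⟩ := hg
  have hmonic₂ : (X ^ 2 - C σ).Monic := monic_X_pow_sub_C σ two_ne_zero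
  have hdvd : g ∣ (X ^ 2 - C σ : F[X]) := (hirr.dvd_iff_aeval_eq_zero hx).1 (by simp [hsq])
  have hn : n = 1 := by
    have hle := natDegree_le_of_dvd hdvd hmonic₂.ne_zero
    have hpos := hirr.natDegree_pos
    rw [natDegree_X_pow_sub_C] at hle
    lia
  have hgeq : X ^ 2 - C σ = g :=
    eq_of_monic_of_dvd_of_natDegree_le hmonic hmonic₂ hdvd (by rw [natDegree_X_pow_sub_C]; lia)
  subst hn hgeq
  have htwo : (2 : F) = 0 := by
    have hneg : -σ = σ := by simpa using hcoeff
    exact (mul_eq_zero.1 (by linear_combination -hneg : 2 * σ = 0)).resolve_right hσ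
  refine (separable_iff_derivative_ne_zero hirr).1
    (PerfectField.separable_of_irreducible hirr) ?_
  simp [one_add_one_eq_two, htwo]

end InversionTransform

section Inversion

variable {K : Type*} [Field K] {a x : K}

/-- The involution `x ↦ a / x`. By the convention `a / 0 = 0` it fixes `0`. -/
def inversion (a : K) : K → K := (a / ·)

theorem involutive_inversion (ha : a ≠ 0) : Involutive (inversion a) := fun _ ↦
  div_div_cancel₀ ha

theorem inversion_eq_self_iff (hx : x ≠ 0) : inversion a x = x ↔ x ^ 2 = a := by
  rw [inversion, div_eq_iff hx, sq, eq_comm]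

theorem ne_zero_of_inversion_ne (h : inversion a x ≠ x) : x ≠ 0 := by
  rintro rfl
  exact h (div_zero a)

end Inversion

section Fields

theorem ncard_eq_mul_ncard_image {α β : Type*} {s : Set α} (hs : s.Finite) (f : α → β) {k : ℕ}
    (hk : ∀ a ∈ s, {b ∈ s | f b = f a}.ncard = k) : s.ncard = k * (f '' s).ncard := by
  classical
  lift s to Finset α using hs
  rw [← Finset.coe_image, Set.ncard_coe_finset, Set.ncard_coe_finset, mul_comm,
    Finset.card_eq_sum_card_image f]
  refine Finset.sum_const_nat fun _ h ↦ ?_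
  obtain ⟨a, ha, rfl⟩ := Finset.mem_image.1 h
  rw [← hk a ha, ← Set.ncard_coe_finset, Finset.coe_filter]
  rfl

variable {F K : Type*} [Field F] [Field K]

theorem ncard_setOf_sq_eq_sq {s : K} (hs : s ≠ 0) :
    {x | x ^ 2 = s ^ 2}.ncard = if ringChar K = 2 then 1 else 2 := by
  have hset : {x | x ^ 2 = s ^ 2} = {s, -s} := Set.ext fun _ ↦ sq_eq_sq_iff_eq_or_eq_neg
  rw [hset]
  split_ifs with hchar
  · have : CharP K 2 := ringChar.of_eq hchar
    rw [CharTwo.neg_eq, Set.pair_eq_singleton, Set.ncard_singleton]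
  · exact Set.ncard_pair fun h ↦ hs ((Ring.eq_self_iff_eq_zero_of_char_ne_two hchar).1 h.symm)

theorem exists_ne_zero_sq_eq [IsAlgClosed K] {a : K} (ha : a ≠ 0) : ∃ s ≠ 0, s ^ 2 = a := by
  obtain ⟨s, rfl⟩ := IsAlgClosed.exists_pow_nat_eq a two_pos
  exact ⟨s, (pow_ne_zero_iff two_ne_zero).1 ha, rfl⟩

variable [Algebra F K]

theorem ncard_rootSet_of_separable [IsAlgClosed K] {p : F[X]} (hp : p.Separable) :
    (p.rootSet K).ncard = p.natDegree := by
  rw [← Nat.card_coe_set_eq, Nat.card_eq_fintype_card,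
    card_rootSet_eq_natDegree hp (IsAlgClosed.splits _)]

theorem setOf_minpoly_eq_minpoly {x : K} (hx : IsIntegral F x) :
    {y | minpoly F y = minpoly F x} = (minpoly F x).rootSet K := by
  ext y
  rw [mem_rootSet, Set.mem_ofPred_eq]
  refine ⟨fun h ↦ ⟨minpoly.ne_zero hx, h ▸ minpoly.aeval F y⟩, fun h ↦ ?_⟩
  exact (minpoly.eq_of_irreducible_of_monic (minpoly.irreducible hx) h.2 (minpoly.monic hx)).symm

end Fields

section Frobenius

variable {F K : Type*} [Field F] [Fintype F] [Field K] [Algebra F K] {σ : F} {x y : K} {n : ℕ}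

local notation "q" => Fintype.card F
local notation "φ" => (FiniteField.frobeniusAlgHom F K : K → K)
local notation "ι" => inversion (algebraMap F K σ)

theorem iterate_frobeniusAlgHom (k : ℕ) (x : K) : φ^[k] x = x ^ q ^ k := by
  rw [FiniteField.coe_frobeniusAlgHom, pow_iterate]

theorem commute_frobenius_inversion : Function.Commute φ ι := fun x ↦ by
  rw [inversion, map_div₀, AlgHom.commutes, inversion]

theorem isPeriodicPt_frobenius_iff_natDegree_minpoly_dvd (hx : IsIntegral F x) (k : ℕ) :
    IsPeriodicPt φ k x ↔ (minpoly F x).natDegree ∣ k := by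
  rw [(minpoly.irreducible hx).natDegree_dvd_iff_dvd_X_pow_card_pow_sub_X, minpoly.dvd_iff,
    Nat.card_eq_fintype_card, IsPeriodicPt, IsFixedPt, iterate_frobeniusAlgHom, map_sub, map_pow,
    aeval_X, sub_eq_zero]

theorem minimalPeriod_frobenius_eq_natDegree_minpoly (hx : IsIntegral F x) :
    minimalPeriod φ x = (minpoly F x).natDegree :=
  Nat.dvd_right_iff_eq.1 fun k ↦ by
    rw [← isPeriodicPt_iff_minimalPeriod_dvd, isPeriodicPt_frobenius_iff_natDegree_minpoly_dvd hx]

theorem aeval_iterate_frobenius_minpoly (x : K) (k : ℕ) : aeval (φ^[k] x) (minpoly F x) = 0 := by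
  rw [← AlgHom.coe_pow, aeval_algHom_apply, minpoly.aeval, map_zero]

theorem exists_iterate_frobenius_eq (hx : IsIntegral F x) (hy : aeval y (minpoly F x) = 0) :
    ∃ k, y = φ^[k] x := by
  have horbit : (φ^[·] x) '' Set.Iio (minimalPeriod φ x) = (minpoly F x).rootSet K := by
    refine Set.eq_of_subset_of_ncard_le ?_ ?_ (rootSet_finite _ _)
    · rintro _ ⟨k, -, rfl⟩
      exact mem_rootSet.2 ⟨minpoly.ne_zero hx, aeval_iterate_frobenius_minpoly x k⟩
    · rw [iterate_injOn_Iio_minimalPeriod.ncard_image, Set.ncard_Iio_nat,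
        minimalPeriod_frobenius_eq_natDegree_minpoly hx]
      exact ncard_rootSet_le _ _
  obtain ⟨k, -, hk⟩ := horbit.symm ▸ mem_rootSet.2 ⟨minpoly.ne_zero hx, hy⟩
  exact ⟨k, hk.symm⟩

theorem mem_halfPeriodPts_of_minpoly_mem (hx : IsIntegral F x) (hσ : σ ≠ 0)
    (h : minpoly F x ∈ invariantIrreducibles F n σ) : x ∈ halfPeriodPts φ ι n := by
  have hsq := sq_ne_of_mem_invariantIrreducibles hσ h (minpoly.aeval F x)
  obtain ⟨-, -, hdeg, hinv⟩ := mem_invariantIrreducibles_iff.1 h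
  have hx₀ : x ≠ 0 := by
    rintro rfl
    rw [minpoly.zero, natDegree_X] at hdeg
    lia
  have hσ' : algebraMap F K σ ≠ 0 := (_root_.map_ne_zero _).2 hσ
  have hroot : aeval (inversion (algebraMap F K σ) x) (minpoly F x) = 0 := by
    have := aeval_inversionTransform σ hdeg.le hx₀
    rw [hinv, map_mul, minpoly.aeval, mul_zero, eq_comm, mul_eq_zero] at this
    exact this.resolve_left (pow_ne_zero _ hx₀)
  obtain ⟨k, hk⟩ := exists_iterate_frobenius_eq hx hroot
  obtain ⟨m, -, -, -, hm⟩ := exists_odd_mem_halfPeriodPts commute_frobenius_inversion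
    (involutive_inversion hσ') hk.symm (mt (inversion_eq_self_iff hx₀).1 hsq)
  have hmn : 2 * m = 2 * n := by rw [← hm.2, minimalPeriod_frobenius_eq_natDegree_minpoly hx, hdeg]
  rwa [Nat.eq_of_mul_eq_mul_left two_pos hmn] at hm

theorem aeval_minpoly_ne_zero_of_mem_halfPeriodPts (hx : IsIntegral F x) (hn : n ≠ 0)
    (h : x ∈ halfPeriodPts φ ι n) (hy : y ^ 2 = algebraMap F K σ) :
    aeval y (minpoly F x) ≠ 0 := by
  intro hroot
  obtain ⟨k, rfl⟩ := exists_iterate_frobenius_eq hx hroot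
  have hne := ne_of_mem_halfPeriodPts hn
    (iterate_mem_halfPeriodPts commute_frobenius_inversion hn h k)
  exact hne ((inversion_eq_self_iff (ne_zero_of_inversion_ne hne)).2 hy)

theorem minpoly_mem_of_mem_halfPeriodPts [IsAlgClosed K] (hx : IsIntegral F x) (hσ : σ ≠ 0)
    (hn : n ≠ 0) (h : x ∈ halfPeriodPts φ ι n) :
    minpoly F x ∈ invariantIrreducibles F n σ := by
  have hdeg : (minpoly F x).natDegree = 2 * n := by
    rw [← minimalPeriod_frobenius_eq_natDegree_minpoly hx, h.2]
  refine mem_invariantIrreducibles_iff.2 ⟨minpoly.monic hx, minpoly.irreducible hx, hdeg, ?_⟩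
  have hx₀ := ne_zero_of_inversion_ne (ne_of_mem_halfPeriodPts hn h)
  have hdvd : minpoly F x ∣ inversionTransform σ (2 * n) (minpoly F x) := minpoly.dvd F x <| by
    rw [aeval_inversionTransform σ hdeg.le hx₀, ← inversion, ← h.1,
      aeval_iterate_frobenius_minpoly, mul_zero]
  obtain ⟨c, hc⟩ : ∃ c, inversionTransform σ (2 * n) (minpoly F x) = C c * minpoly F x :=
    ⟨_, eq_leadingCoeff_mul_of_monic_of_dvd_of_natDegree_le (minpoly.monic hx) hdvd
      ((natDegree_inversionTransform_le σ hdeg.le).trans hdeg.ge)⟩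
  -- Evaluating at a square root of `σ`, which is fixed by `ι`, shows that `c = σ ^ n`.
  obtain ⟨s, hs₀, hs⟩ := exists_ne_zero_sq_eq ((_root_.map_ne_zero (algebraMap F K)).2 hσ)
  have heval := aeval_inversionTransform σ hdeg.le hs₀
  rw [hc, map_mul, aeval_C, (div_eq_iff hs₀).2 (hs.symm.trans (sq s)), pow_mul, hs, ← map_pow]
    at heval
  rw [hc, (algebraMap F K).injective (mul_right_cancel₀
    (aeval_minpoly_ne_zero_of_mem_halfPeriodPts hx hn h hs) heval)]

theorem invariantIrreducibles_eq_image_minpoly [IsAlgClosed K] [Algebra.IsAlgebraic F K]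
    (hσ : σ ≠ 0) (hn : n ≠ 0) :
    invariantIrreducibles F n σ = minpoly F '' halfPeriodPts φ ι n := by
  ext g
  constructor
  · intro hg
    obtain ⟨x, hx⟩ := IsAlgClosed.exists_aeval_eq_zero K g hg.2.1.degree_pos.ne'
    obtain rfl := minpoly.eq_of_irreducible_of_monic hg.2.1 hx hg.1
    exact ⟨x, mem_halfPeriodPts_of_minpoly_mem (Algebra.IsIntegral.isIntegral x) hσ hg, rfl⟩
  · rintro ⟨x, hx, rfl⟩
    exact minpoly_mem_of_mem_halfPeriodPts (Algebra.IsIntegral.isIntegral x) hσ hn hx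

variable (K) in
/-- The square roots of `σ` in `K` fixed by the `n`-th power of the Frobenius: the solutions of
`x ^ (qⁿ + 1) = σ` that are not counted by `halfPeriodPts`. -/
def periodicSqrts (n : ℕ) (σ : F) : Set K :=
  {x | x ^ 2 = algebraMap F K σ ∧ IsPeriodicPt φ n x}

theorem rootSet_X_pow_card_pow_add_one_sub_C (hσ : σ ≠ 0) (n : ℕ) :
    (X ^ (q ^ n + 1) - C σ : F[X]).rootSet K =
      {x | φ^[n] x = ι x ∧ ι x ≠ x} ∪ periodicSqrts K n σ := by
  have hσ' : algebraMap F K σ ≠ 0 := (_root_.map_ne_zero _).2 hσ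
  ext x
  rw [mem_rootSet_of_ne (X_pow_sub_C_ne_zero (Nat.succ_pos _) σ), map_sub, map_pow, aeval_X,
    aeval_C, sub_eq_zero]
  rcases eq_or_ne x 0 with rfl | hx
  · simp [periodicSqrts, inversion, hσ'.symm]
  · have hpow : x ^ (q ^ n + 1) = algebraMap F K σ ↔ φ^[n] x = ι x := by
      rw [iterate_frobeniusAlgHom, inversion, eq_div_iff hx, pow_succ]
    rw [hpow, periodicSqrts, Set.mem_union, Set.mem_ofPred_eq, Set.mem_ofPred_eq,
      ← inversion_eq_self_iff hx, IsPeriodicPt, IsFixedPt]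
    grind

theorem disjoint_periodicSqrts (n : ℕ) :
    Disjoint {x | φ^[n] x = ι x ∧ ι x ≠ x} (periodicSqrts K n σ) :=
  Set.disjoint_left.2 fun _ h hx ↦
    h.2 ((inversion_eq_self_iff (ne_zero_of_inversion_ne h.2)).2 hx.1)

theorem finite_setOf_iterate_frobenius_eq (hσ : σ ≠ 0) (n : ℕ) :
    {x : K | φ^[n] x = ι x ∧ ι x ≠ x}.Finite :=
  (rootSet_finite _ _).subset
    (Set.subset_union_left.trans (rootSet_X_pow_card_pow_add_one_sub_C hσ n).ge)

theorem finite_halfPeriodPts_frobenius (hσ : σ ≠ 0) (hn : n ≠ 0) :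
    (halfPeriodPts φ ι n).Finite :=
  (finite_setOf_iterate_frobenius_eq hσ n).subset fun _ hx ↦
    ⟨hx.1, ne_of_mem_halfPeriodPts hn hx⟩

theorem ncard_halfPeriodPts_frobenius_eq_mul [IsAlgClosed K] [Algebra.IsAlgebraic F K] (hσ : σ ≠ 0)
    (hn : n ≠ 0) :
    (halfPeriodPts φ ι n).ncard = 2 * n * (invariantIrreducibles F n σ).ncard := by
  rw [invariantIrreducibles_eq_image_minpoly (K := K) hσ hn]
  refine ncard_eq_mul_ncard_image (finite_halfPeriodPts_frobenius hσ hn) (minpoly F)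
    fun x hx ↦ ?_
  have hint : IsIntegral F x := Algebra.IsIntegral.isIntegral x
  have hfiber : {y ∈ halfPeriodPts φ ι n | minpoly F y = minpoly F x} =
      (minpoly F x).rootSet K := by
    rw [← setOf_minpoly_eq_minpoly hint]
    ext y
    refine and_iff_right_of_imp fun hy ↦ ?_
    refine mem_halfPeriodPts_of_minpoly_mem (Algebra.IsIntegral.isIntegral y) hσ ?_
    rw [hy]
    exact minpoly_mem_of_mem_halfPeriodPts hint hσ hn hx
  rw [hfiber, ncard_rootSet_of_separable
    (PerfectField.separable_of_irreducible (minpoly.irreducible hint)),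
    ← minimalPeriod_frobenius_eq_natDegree_minpoly hint, hx.2]

theorem ncard_setOf_iterate_frobenius_eq_add_ncard_periodicSqrts [IsAlgClosed K] (hσ : σ ≠ 0)
    (hn : n ≠ 0) :
    {x : K | φ^[n] x = ι x ∧ ι x ≠ x}.ncard + (periodicSqrts K n σ).ncard = q ^ n + 1 := by
  have hroots := rootSet_X_pow_card_pow_add_one_sub_C (K := K) hσ n
  have hfin := hroots ▸ rootSet_finite (X ^ (q ^ n + 1) - C σ : F[X]) K
  have hsep : (X ^ (q ^ n + 1) - C σ : F[X]).Separable :=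
    separable_X_pow_sub_C σ (by simp [hn]) hσ
  rw [← Set.ncard_union_eq (disjoint_periodicSqrts n) (hfin.subset Set.subset_union_left)
    (hfin.subset Set.subset_union_right), ← hroots, ncard_rootSet_of_separable hsep,
    natDegree_X_pow_sub_C]

theorem isPeriodicPt_two_frobenius_of_sq_eq (hx : x ^ 2 = algebraMap F K σ) :
    IsPeriodicPt φ 2 x := by
  have h : FiniteField.frobeniusAlgHom F K x ^ 2 = x ^ 2 := by
    rw [← map_pow, hx, AlgHom.commutes]
  rw [IsPeriodicPt, IsFixedPt, iterate_succ_apply, iterate_one]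
  rcases sq_eq_sq_iff_eq_or_eq_neg.1 h with h | h
  · rw [h, h]
  · rw [h, map_neg, h, neg_neg]

theorem isFixedPt_frobenius_iff_of_sq_eq (hx : x ^ 2 = algebraMap F K σ) :
    IsFixedPt φ x ↔ IsSquare σ := by
  have hint : IsIntegral F x := .of_pow two_pos (hx ▸ isIntegral_algebraMap)
  have hone : IsFixedPt φ x ↔ IsPeriodicPt φ 1 x := Iff.rfl
  rw [hone, isPeriodicPt_frobenius_iff_natDegree_minpoly_dvd hint, Nat.dvd_one,
    minpoly.natDegree_eq_one_iff, isSquare_iff_exists_sq]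
  constructor
  · rintro ⟨t, rfl⟩
    exact ⟨t, (algebraMap F K).injective (by rw [← hx, map_pow])⟩
  · rintro ⟨t, rfl⟩
    rw [map_pow] at hx
    rcases sq_eq_sq_iff_eq_or_eq_neg.1 hx with rfl | rfl
    · exact ⟨t, rfl⟩
    · exact ⟨-t, map_neg _ t⟩

theorem isPeriodicPt_frobenius_iff_of_sq_eq (hx : x ^ 2 = algebraMap F K σ) :
    IsPeriodicPt φ n x ↔ Even n ∨ IsSquare σ := by
  have htwo := isPeriodicPt_two_frobenius_of_sq_eq hx
  rcases Nat.even_or_odd n with heven | hodd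
  · exact iff_of_true (htwo.trans_dvd heven.two_dvd) (.inl heven)
  · rw [or_iff_right (Nat.not_even_iff_odd.2 hodd), ← isFixedPt_frobenius_iff_of_sq_eq hx]
    refine ⟨fun h ↦ ?_, fun h ↦ IsFixedPt.isPeriodicPt h n⟩
    have hgcd := h.gcd htwo
    rwa [Nat.coprime_two_right.2 hodd] at hgcd

theorem periodicSqrts_div {d : ℕ} (hd : Odd d) (hdn : d ∣ n) :
    periodicSqrts K (n / d) σ = periodicSqrts K n σ := by
  obtain ⟨m, rfl⟩ := hdn
  rw [Nat.mul_div_cancel_left m hd.pos]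
  ext x
  refine and_congr_right fun hx ↦ ?_
  rw [isPeriodicPt_frobenius_iff_of_sq_eq hx, isPeriodicPt_frobenius_iff_of_sq_eq hx,
    Nat.even_mul, or_iff_right (Nat.not_even_iff_odd.2 hd)]

theorem ncard_setOf_sq_eq_algebraMap [IsAlgClosed K] (hσ : σ ≠ 0) :
    {x : K | x ^ 2 = algebraMap F K σ}.ncard = if Odd q then 2 else 1 := by
  obtain ⟨s, hs₀, hs⟩ := exists_ne_zero_sq_eq ((_root_.map_ne_zero (algebraMap F K)).2 hσ)
  rw [← hs, ncard_setOf_sq_eq_sq hs₀, ← Algebra.ringChar_eq F K]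
  simp only [FiniteField.even_card_iff_char_two, ← Nat.even_iff, ← Nat.not_odd_iff_even, ite_not]

open scoped Classical in
theorem ncard_periodicSqrts [IsAlgClosed K] (hσ : σ ≠ 0) (n : ℕ) :
    (periodicSqrts K n σ).ncard =
      if Even n ∨ IsSquare σ then (if Odd q then 2 else 1) else 0 := by
  have hset : periodicSqrts K n σ = {x | x ^ 2 = algebraMap F K σ ∧ (Even n ∨ IsSquare σ)} :=
    Set.ext fun x ↦ and_congr_right isPeriodicPt_frobenius_iff_of_sq_eq
  rw [hset, ← ncard_setOf_sq_eq_algebraMap (K := K) hσ]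
  split_ifs with h <;> simp only [h, and_true, and_false, Set.ofPred_false, Set.ncard_empty]

open scoped Classical in
theorem delta_eq_ite_ncard_periodicSqrts [IsAlgClosed K] (hσ : σ ≠ 0) (n : ℕ) :
    delta n σ = if ∃ k, n = 2 ^ k then ((periodicSqrts K n σ).ncard : ℤ) - 1 else 0 := by
  rw [ncard_periodicSqrts hσ, delta]
  by_cases hq : Odd q
  · by_cases hpow : ∃ k, n = 2 ^ k
    · rcases eq_or_ne n 1 with rfl | hn
      · by_cases hs : IsSquare σ <;> simp [hq, hs, hpow]
      · obtain ⟨k, rfl⟩ := id hpow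
        have hk : k ≠ 0 := by rintro rfl; exact hn (pow_zero 2)
        have heven : Even (2 ^ k) := even_two.pow_of_ne_zero hk
        simp [hq, heven, hk]
    · have hn : n ≠ 1 := fun h ↦ hpow ⟨0, h⟩
      simp only [hpow, hn, and_false, false_and, if_false]
  · have hsq : IsSquare σ := FiniteField.isSquare_of_char_two
      (FiniteField.even_card_iff_char_two.2 (Nat.even_iff.1 (Nat.not_odd_iff_even.1 hq))) σ
    simp [hq, hsq]

theorem sum_odd_divisors_ncard_halfPeriodPts_frobenius [IsAlgClosed K] (hσ : σ ≠ 0)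
    (hn : n ≠ 0) :
    ∑ d ∈ n.divisors with Odd d, ((halfPeriodPts φ ι (n / d)).ncard : ℤ) =
      q ^ n + 1 - (periodicSqrts K n σ).ncard := by
  have hι : Involutive ι := involutive_inversion ((_root_.map_ne_zero _).2 hσ)
  have hcount := ncard_setOf_iterate_frobenius_eq_add_ncard_periodicSqrts (K := K) hσ hn
  rw [ncard_setOf_iterate_eq_eq_sum commute_frobenius_inversion hι hn
    (finite_setOf_iterate_frobenius_eq hσ n)] at hcount
  rw [eq_sub_iff_add_eq]
  exact_mod_cast hcount

open scoped ArithmeticFunction.Moebius in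
theorem ncard_halfPeriodPts_frobenius_eq_sum_sub_delta [IsAlgClosed K] (hσ : σ ≠ 0) (hn : n ≠ 0) :
    ((halfPeriodPts φ ι n).ncard : ℤ) =
      ∑ d ∈ n.divisors with Odd d, μ d * (q : ℤ) ^ (n / d) - delta n σ := by
  classical
  have hterm (d : ℕ) (hd : d ∈ n.divisors.filter Odd) :
      μ d • ((q : ℤ) ^ (n / d) + 1 - (periodicSqrts K (n / d) σ).ncard) =
        μ d * (q : ℤ) ^ (n / d) - μ d * ((periodicSqrts K n σ).ncard - 1) := by
    obtain ⟨hdvd, hodd⟩ := Finset.mem_filter.1 hd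
    rw [periodicSqrts_div hodd (Nat.dvd_of_mem_divisors hdvd), smul_eq_mul]
    ring
  rw [eq_sum_odd_divisors_moebius_smul (f := fun k ↦ ((halfPeriodPts φ ι k).ncard : ℤ))
    (fun _ hk ↦ sum_odd_divisors_ncard_halfPeriodPts_frobenius hσ hk) hn,
    Finset.sum_congr rfl hterm, Finset.sum_sub_distrib, ← Finset.sum_mul,
    sum_odd_divisors_moebius hn, ite_mul, one_mul, zero_mul,
    delta_eq_ite_ncard_periodicSqrts (K := K) hσ]

end Frobenius

theorem corollary3p5 {F : Type*} [Field F] [Fintype F] (σ : F) (hσ : σ ≠ 0)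
    (n : ℕ) (hn : 1 ≤ n) :
    (invariantIrreducibles F n σ).Finite ∧
    ((invariantIrreducibles F n σ).ncard : ℚ) =
      1 / (2 * (n : ℚ)) *
        (-(delta n σ : ℚ) +
          ∑ d ∈ n.divisors with Odd d,
            (ArithmeticFunction.moebius d : ℚ) * (Fintype.card F : ℚ) ^ (n / d)) := by
  have hn₀ : n ≠ 0 := Nat.one_le_iff_ne_zero.1 hn
  constructor
  · rw [invariantIrreducibles_eq_image_minpoly (K := AlgebraicClosure F) hσ hn₀]
    exact (finite_halfPeriodPts_frobenius hσ hn₀).image _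
  · have hcount := ncard_halfPeriodPts_frobenius_eq_sum_sub_delta (K := AlgebraicClosure F) hσ hn₀
    rw [ncard_halfPeriodPts_frobenius_eq_mul hσ hn₀] at hcount
    have hcount' := congrArg (Int.cast : ℤ → ℚ) hcount
    push_cast at hcount'
    field_simp
    linear_combination hcount'
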